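/- Let $d\ge 2$ and $R(z)=\dfrac{z^d}{a_0z^d+a_1z^{d-1}+\dots+a_{d-1}z+a_d}$ with $a_0,\dots,a_d\in\mathbb{C}$, $a_d\neq 0$ and $a_{d-1}=0$, regarded as a self-map of $\widehat{\mathbb{C}}=\mathbb{C}\cup\{\infty\}$, and suppose that $0$ is the only exceptional point of $R$, i.e. the only point whose backward orbit $\{z: R^n(z)=w \text{ for some } n\ge 0\}$ is finite. For a rational map $S$, let $\mathcal{J}(S)$ be its Julia set, i.e. the complement in $\widehat{\mathbb{C}}$ of the largest open set on which the iterates $S^n$, $n>0$, are equicontinuous for the chordal metric, and let $\Sigma S$ be the group of all maps $\sigma(z)=az+b$ with $|a|=1$ and $\sigma(\mathcal{J}(S))=\mathcal{J}(S)$. Let $\beta$ be the order of rotational symmetries of $R$, i.e. the order of the group $\Sigma p$, where $p$ is a normalized (monic, with vanishing coefficient of $z^{\deg p-1}$, of degree at least two) polynomial conjugate to $R$ by a Möbius map. If $\beta\ge 2$ and $\mathcal{J}(R)$ is not invariant under any translation $z\mapsto z+b$, $b\neq 0$, then $$\Sigma R=\{z\mapsto \lambda z:\lambda^\beta=1\}.$$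 -/

import Mathlib

open Polynomial
open scoped OnePoint

noncomputable section

/-- The self-map of the Riemann sphere `OnePoint ℂ` given by the rational function `P / Q`, for
coprime polynomials `P` and `Q`. With `n = max (deg P) (deg Q)`, the value at `∞` is the ratio of
the coefficients of `X ^ n`. -/
def rationalMap (P Q : ℂ[X]) : OnePoint ℂ → OnePoint ℂ
  | OnePoint.some z => if Q.eval z = 0 then ∞ else ((P.eval z / Q.eval z : ℂ) : OnePoint ℂ)
  | ∞ =>
    if Q.coeff (max P.natDegree Q.natDegree) = 0 then ∞
    else ((P.coeff (max P.natDegree Q.natDegree) / Q.coeff (max P.natDegree Q.natDegree) : ℂ) :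
      OnePoint ℂ)

/-- The self-map of the Riemann sphere given by a polynomial. -/
def polynomialMap (p : ℂ[X]) : OnePoint ℂ → OnePoint ℂ := rationalMap p 1

/-- The chordal distance on the Riemann sphere. -/
def chordalDist : OnePoint ℂ → OnePoint ℂ → ℝ
  | OnePoint.some z, OnePoint.some w => 2 * ‖z - w‖ / (√(1 + ‖z‖ ^ 2) * √(1 + ‖w‖ ^ 2))
  | OnePoint.some z, ∞ => 2 / √(1 + ‖z‖ ^ 2)
  | ∞, OnePoint.some w => 2 / √(1 + ‖w‖ ^ 2)
  | ∞, ∞ => 0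

/-- The iterates `f^n`, `n > 0`, form an equicontinuous family on `U` for the chordal metric. -/
def IteratesEquicontinuousOn (f : OnePoint ℂ → OnePoint ℂ) (U : Set (OnePoint ℂ)) : Prop :=
  ∀ z ∈ U, ∀ ε > 0, ∃ δ > 0, ∀ w ∈ U, chordalDist z w < δ →
    ∀ n : ℕ, 0 < n → chordalDist (f^[n] z) (f^[n] w) < ε

/-- The Fatou set: the largest open set on which the iterates are equicontinuous, that is, the
union of all such open sets. -/
def fatouSet (f : OnePoint ℂ → OnePoint ℂ) : Set (OnePoint ℂ) :=
  ⋃₀ {U | IsOpen U ∧ IteratesEquicontinuousOn f U}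

/-- The Julia set. -/
def juliaSet (f : OnePoint ℂ → OnePoint ℂ) : Set (OnePoint ℂ) := (fatouSet f)ᶜ

/-- The map `z ↦ a z + b` on the Riemann sphere, fixing `∞`. -/
def affineMap (a b : ℂ) : OnePoint ℂ → OnePoint ℂ := OnePoint.map fun z => a * z + b

/-- The symmetry group `Σ f`: the orientation-preserving Euclidean isometries `z ↦ a z + b`,
`|a| = 1`, that preserve the Julia set of `f`. -/
def symmetryGroup (f : OnePoint ℂ → OnePoint ℂ) : Set (OnePoint ℂ → OnePoint ℂ) :=
  {σ | (∃ a b : ℂ, ‖a‖ = 1 ∧ σ = affineMap a b) ∧ σ '' juliaSet f = juliaSet f}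

/-- A point is exceptional if its backward orbit is finite. -/
def IsExceptionalPoint (f : OnePoint ℂ → OnePoint ℂ) (w : OnePoint ℂ) : Prop :=
  {z | ∃ n : ℕ, f^[n] z = w}.Finite

/-- A normalized polynomial: of degree at least two, monic and centered. -/
def IsNormalizedPolynomial (p : ℂ[X]) : Prop :=
  2 ≤ p.natDegree ∧ p.Monic ∧ p.coeff (p.natDegree - 1) = 0

/-- `f` and `g` are conjugate by a Möbius map: `g = φ ∘ f ∘ φ⁻¹`, where a Möbius map is the
action of an element of `GL (Fin 2) ℂ` on the Riemann sphere. -/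
def IsMobiusConjugate (f g : OnePoint ℂ → OnePoint ℂ) : Prop :=
  ∃ φ : GL (Fin 2) ℂ, ∀ z : OnePoint ℂ, g z = φ • f (φ⁻¹ • z)

/-- `β` is the order of rotational symmetries of `f`: the (finite) order of the symmetry group of
a normalized polynomial conjugate to `f`. -/
def IsOrderOfRotationalSymmetries (f : OnePoint ℂ → OnePoint ℂ) (β : ℕ) : Prop :=
  ∃ p : ℂ[X], IsNormalizedPolynomial p ∧ IsMobiusConjugate f (polynomialMap p) ∧
    (symmetryGroup (polynomialMap p)).encard = β

end

/-! A Möbius map `φ` taking `R` to a normalized polynomial `p` sends `0` to `∞`: since `p⁻¹(∞) =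
{∞}`, the point `φ⁻¹(∞)` is exceptional, hence `0`. So `φ z = γ + α / z`, and comparing subleading
coefficients, which vanish for `p` and for `∑ a i * X ^ i`, gives `γ = 0`
(`exists_divMap_semiconj`). The involution `z ↦ α / z` is chordally Lipschitz, so it carries the
Julia set of `R` to that of `p`, and it turns the rotation by `μ` into the rotation by `μ⁻¹`.

On the polynomial side every symmetry fixes `0` (`IsCenteredAtInfty.translation_eq_zero`). For
centered `p` the Green function of the filled Julia set is `log ‖z‖ + O(‖z‖⁻²)`; a symmetry `z ↦ a z
+ b` cannot increase it, whereas `b ≠ 0` would change `log ‖z‖` by order `1 / ‖z‖` in the direction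
of `b / a`. The symmetries thus form a group of `β` rotations, that is, the `β`-th roots of unity.

The rotations of the Julia set of `R` are therefore known. If `z ↦ a z + b` is another symmetry and
`μ ≠ 1` is a `β`-th root of unity, the commutator of the two is the translation by `(μ - 1) b`, so
`b = 0`. -/

/-! ### The chordal distance and the topology of the sphere. -/

lemma sqrt_one_add_norm_sq_pos (z : ℂ) : 0 < √(1 + ‖z‖ ^ 2) := by positivity

lemma one_le_sqrt_one_add_norm_sq (z : ℂ) : 1 ≤ √(1 + ‖z‖ ^ 2) := by
  rw [Real.one_le_sqrt]; nlinarith [norm_nonneg z]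

@[simp] lemma chordalDist_coe_coe (z w : ℂ) :
    chordalDist z w = 2 * ‖z - w‖ / (√(1 + ‖z‖ ^ 2) * √(1 + ‖w‖ ^ 2)) := rfl

@[simp] lemma chordalDist_coe_infty (z : ℂ) : chordalDist z ∞ = 2 / √(1 + ‖z‖ ^ 2) := rfl

@[simp] lemma chordalDist_infty_coe (z : ℂ) : chordalDist ∞ z = 2 / √(1 + ‖z‖ ^ 2) := rfl

@[simp] lemma chordalDist_infty_infty : chordalDist ∞ ∞ = 0 := rfl

lemma chordalDist_comm (z w : OnePoint ℂ) : chordalDist z w = chordalDist w z := by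
  induction z using OnePoint.rec <;> induction w using OnePoint.rec <;> simp [norm_sub_rev, mul_comm]

lemma chordalDist_coe_le (z w : ℂ) : chordalDist z w ≤ 2 * ‖z - w‖ := by
  rw [chordalDist_coe_coe]
  apply div_le_self (by positivity)
  nlinarith [one_le_sqrt_one_add_norm_sq z, one_le_sqrt_one_add_norm_sq w]

lemma exists_coe_of_chordalDist_lt {z : ℂ} {w : OnePoint ℂ} {δ : ℝ}
    (hδ : δ * √(1 + ‖z‖ ^ 2) ≤ 1) (h : chordalDist z w < δ) :
    ∃ w' : ℂ, w = w' ∧ ‖z - w'‖ ≤ δ * √(1 + ‖z‖ ^ 2) * (1 + ‖z‖) := by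
  have hc := sqrt_one_add_norm_sq_pos z
  induction w using OnePoint.rec with
  | infty =>
    rw [chordalDist_coe_infty, div_lt_iff₀ hc] at h
    linarith
  | coe w =>
    refine ⟨w, rfl, ?_⟩
    have hc' := sqrt_one_add_norm_sq_pos w
    rw [chordalDist_coe_coe, div_lt_iff₀ (by positivity)] at h
    have h1 := sqrt_one_add_norm_sq_le w
    have h2 : ‖w‖ ≤ ‖z‖ + ‖z - w‖ := by
      have := norm_sub_le z (z - w); simpa using this
    have h3 : 0 ≤ δ * √(1 + ‖z‖ ^ 2) := by
      by_contra! hneg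
      nlinarith [norm_nonneg (z - w)]
    -- As `δ * √(1 + ‖z‖ ^ 2) ≤ 1`, the term in `‖z - w‖` coming from `h2` costs only one of the two
    -- copies of `‖z - w‖` on the left.
    nlinarith [norm_nonneg (z - w)]

lemma isOpen_iff_chordalDist {U : Set (OnePoint ℂ)} :
    IsOpen U ↔ ∀ z ∈ U, ∃ δ > 0, ∀ w, chordalDist z w < δ → w ∈ U := by
  constructor
  · intro hU z hz
    induction z using OnePoint.rec with
    | infty =>
      obtain ⟨-, hK⟩ := (OnePoint.isOpen_iff_of_mem hz).1 hU
      obtain ⟨T, hT⟩ := hK.isBounded.exists_norm_le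
      refine ⟨2 / √(1 + T ^ 2), by positivity, fun w hw ↦ ?_⟩
      induction w using OnePoint.rec with
      | infty => exact hz
      | coe w =>
        by_contra hwU
        have h1 := hT w hwU
        rw [chordalDist_infty_coe] at hw
        refine hw.not_ge ?_
        gcongr
    | coe z =>
      have hU' := hU.preimage (OnePoint.continuous_coe (X := ℂ))
      obtain ⟨ε, hε, hball⟩ := Metric.isOpen_iff.1 hU' z hz
      have hc := sqrt_one_add_norm_sq_pos z
      set c := √(1 + ‖z‖ ^ 2)
      have hz0 : 0 < 1 + ‖z‖ := by positivity
      refine ⟨min (1 / c) (ε / 2 / (c * (1 + ‖z‖))), by positivity, fun w hw ↦ ?_⟩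
      obtain ⟨w, rfl, h⟩ := exists_coe_of_chordalDist_lt (by
        calc _ ≤ 1 / c * c := by gcongr; exact min_le_left _ _
          _ = 1 := by field_simp) hw
      apply hball
      rw [Metric.mem_ball, dist_comm, dist_eq_norm]
      calc ‖z - w‖ ≤ _ := h
        _ ≤ ε / 2 / (c * (1 + ‖z‖)) * c * (1 + ‖z‖) := by gcongr; exact min_le_right _ _
        _ = ε / 2 := by field_simp
        _ < ε := by linarith
  · intro h
    have hopen : IsOpen ((↑) ⁻¹' U : Set ℂ) := by
      rw [Metric.isOpen_iff]
      intro z hz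
      obtain ⟨δ, hδ, hU⟩ := h z hz
      refine ⟨δ / 2, by positivity, fun w hw ↦ hU w ?_⟩
      rw [Metric.mem_ball, dist_comm, dist_eq_norm] at hw
      linarith [chordalDist_coe_le z w]
    rw [OnePoint.isOpen_def]
    refine ⟨fun hinf ↦ ?_, hopen⟩
    obtain ⟨δ, hδ, hU⟩ := h ∞ hinf
    refine Metric.isCompact_of_isClosed_isBounded hopen.isClosed_compl ?_
    refine (Metric.isBounded_closedBall (x := (0 : ℂ)) (r := 2 / δ)).subset fun w hw ↦ ?_
    rw [mem_closedBall_zero_iff]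
    by_contra! hlt
    refine hw (hU w ?_)
    rw [chordalDist_infty_coe, div_lt_iff₀ (by positivity)]
    rw [div_lt_iff₀ hδ] at hlt
    have : ‖w‖ ≤ √(1 + ‖w‖ ^ 2) := Real.le_sqrt_of_sq_le (by linarith)
    nlinarith

/-! ### Transport of Julia sets by bi-Lipschitz conjugacies. -/

lemma image_fatouSet_subset_of_semiconj {f g e e' : OnePoint ℂ → OnePoint ℂ} {L : ℝ} (hL : 0 < L)
    (he : ∀ z w, chordalDist (e z) (e w) ≤ L * chordalDist z w)
    (he' : ∀ z w, chordalDist (e' z) (e' w) ≤ L * chordalDist z w)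
    (hee' : Function.LeftInverse e' e) (he'e : Function.LeftInverse e e')
    (h : Function.Semiconj e f g) : e '' fatouSet f ⊆ fatouSet g := by
  rintro _ ⟨z, ⟨U, ⟨hU, hUf⟩, hz⟩, rfl⟩
  refine ⟨e '' U, ⟨?_, ?_⟩, z, hz, rfl⟩
  · rw [isOpen_iff_chordalDist] at hU ⊢
    rintro _ ⟨x, hx, rfl⟩
    obtain ⟨δ, hδ, hxU⟩ := hU x hx
    refine ⟨δ / L, by positivity, fun w hw ↦ ⟨e' w, hxU _ ?_, he'e w⟩⟩
    rw [lt_div_iff₀' hL] at hw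
    have := he' (e x) w
    rw [hee'] at this
    linarith
  · rintro _ ⟨x, hx, rfl⟩ ε hε
    obtain ⟨δ, hδ, hxU⟩ := hUf x hx (ε / L) (by positivity)
    refine ⟨δ / L, by positivity, ?_⟩
    rintro _ ⟨w, hw, rfl⟩ hlt n hn
    rw [lt_div_iff₀' hL] at hlt
    have h1 := he' (e x) (e w)
    rw [hee', hee'] at h1
    have h2 := hxU w hw (by linarith) n hn
    rw [← (h.iterate_right n).eq, ← (h.iterate_right n).eq]
    rw [lt_div_iff₀' hL] at h2
    exact (he _ _).trans_lt h2

lemma juliaSet_eq_image_of_semiconj {f g e e' : OnePoint ℂ → OnePoint ℂ} {L : ℝ} (hL : 0 < L)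
    (he : ∀ z w, chordalDist (e z) (e w) ≤ L * chordalDist z w)
    (he' : ∀ z w, chordalDist (e' z) (e' w) ≤ L * chordalDist z w)
    (hee' : Function.LeftInverse e' e) (he'e : Function.LeftInverse e e')
    (h : Function.Semiconj e f g) : juliaSet g = e '' juliaSet f := by
  have h' : Function.Semiconj e' g f := fun x ↦ by
    rw [← hee' (f (e' x)), h.eq, he'e]
  have h1 := image_fatouSet_subset_of_semiconj hL he he' hee' he'e h
  have h2 := image_fatouSet_subset_of_semiconj hL he' he he'e hee' h'
  rw [juliaSet, juliaSet, Set.image_compl_eq ⟨hee'.injective, he'e.surjective⟩]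
  congr 1
  refine subset_antisymm (fun x hx ↦ ⟨e' x, h2 ⟨x, hx, rfl⟩, he'e x⟩) h1

/-! ### The involution `z ↦ α / z`. -/

/-- The Möbius involution `z ↦ α / z` of the Riemann sphere. -/
noncomputable def divMap (α : ℂ) : OnePoint ℂ → OnePoint ℂ
  | OnePoint.some z => if z = 0 then ∞ else ((α / z : ℂ) : OnePoint ℂ)
  | ∞ => ((0 : ℂ) : OnePoint ℂ)

lemma divMap_coe (α z : ℂ) : divMap α z = if z = 0 then ∞ else ((α / z : ℂ) : OnePoint ℂ) := rfl

@[simp] lemma divMap_infty (α : ℂ) : divMap α ∞ = ((0 : ℂ) : OnePoint ℂ) := rfl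

@[simp] lemma divMap_zero (α : ℂ) : divMap α ((0 : ℂ) : OnePoint ℂ) = ∞ := by simp [divMap_coe]

lemma divMap_coe_of_ne (α : ℂ) {z : ℂ} (hz : z ≠ 0) :
    divMap α z = ((α / z : ℂ) : OnePoint ℂ) := by simp [divMap_coe, hz]

lemma divMap_divMap {α : ℂ} (hα : α ≠ 0) : Function.LeftInverse (divMap α) (divMap α) := by
  intro z
  induction z using OnePoint.rec with
  | infty => simp
  | coe z =>
    by_cases hz : z = 0
    · simp [hz]
    · rw [divMap_coe_of_ne α hz, divMap_coe_of_ne α (div_ne_zero hα hz), div_div_cancel₀ hα]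

lemma exists_chordalDist_divMap_le {α : ℂ} (hα : α ≠ 0) :
    ∃ L > 0, ∀ z w, chordalDist (divMap α z) (divMap α w) ≤ L * chordalDist z w := by
  have hα' : 0 < ‖α‖ := norm_pos_iff.2 hα
  set m := min 1 ‖α‖ with hm
  have hm0 : 0 < m := by positivity
  have hm1 : m ≤ 1 := min_le_left _ _
  have hma : m ≤ ‖α‖ := min_le_right _ _
  have hmL : 1 / m ≤ ‖α‖ / m ^ 2 := by
    rw [div_le_div_iff₀ hm0 (by positivity)]; nlinarith
  have hmL' : 1 ≤ ‖α‖ / m ^ 2 := le_trans (by rw [le_div_iff₀ hm0]; linarith) hmL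
  -- This rests on `‖z‖² + ‖α‖² ≥ m² (1 + ‖z‖²)`. Each of the two points contributes a factor `1 /
  -- m`, and `α / z - α / w` contributes `‖α‖`; hence the Lipschitz constant `‖α‖ / m²`.
  have key : ∀ z : ℂ, z ≠ 0 → 1 / √(1 + ‖α / z‖ ^ 2) ≤ ‖z‖ / (m * √(1 + ‖z‖ ^ 2)) := by
    intro z hz
    have hz' : 0 < ‖z‖ := norm_pos_iff.2 hz
    have hc := sqrt_one_add_norm_sq_pos z
    rw [div_le_div_iff₀ (by positivity) (by positivity), one_mul]
    refine le_of_sq_le_sq ?_ (by positivity)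
    rw [mul_pow, mul_pow, Real.sq_sqrt (by positivity), Real.sq_sqrt (by positivity), norm_div]
    have h1 : ‖z‖ ^ 2 * (1 + (‖α‖ / ‖z‖) ^ 2) = ‖z‖ ^ 2 + ‖α‖ ^ 2 := by field_simp
    rw [h1]
    have h2 : m ^ 2 ≤ ‖α‖ ^ 2 := by gcongr
    have h3 : m ^ 2 ≤ 1 := by nlinarith
    nlinarith [sq_nonneg ‖z‖]
  have key2 : ∀ z : ℂ, z ≠ 0 →
      chordalDist (divMap α ∞) (divMap α z) ≤ ‖α‖ / m ^ 2 * chordalDist ∞ z := by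
    intro z hz
    have hz' : 0 < ‖z‖ := norm_pos_iff.2 hz
    rw [divMap_infty, divMap_coe_of_ne α hz, chordalDist_coe_coe, chordalDist_infty_coe]
    have hc := sqrt_one_add_norm_sq_pos z
    calc _ = 2 * (‖α‖ / ‖z‖) * (1 / √(1 + ‖α / z‖ ^ 2)) := by simp; ring
      _ ≤ 2 * (‖α‖ / ‖z‖) * (‖z‖ / (m * √(1 + ‖z‖ ^ 2))) := mul_le_mul_of_nonneg_left (key z hz) (by positivity)
      _ = (‖α‖ * m) / m ^ 2 * (2 / √(1 + ‖z‖ ^ 2)) := by field_simp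
      _ ≤ _ := by gcongr; nlinarith
  have key3 : ∀ z : ℂ, z ≠ 0 →
      chordalDist (divMap α (0 : ℂ)) (divMap α z) ≤ ‖α‖ / m ^ 2 * chordalDist (0 : ℂ) z := by
    intro z hz
    have hz' : 0 < ‖z‖ := norm_pos_iff.2 hz
    rw [divMap_zero, divMap_coe_of_ne α hz, chordalDist_coe_coe, chordalDist_infty_coe]
    have hc := sqrt_one_add_norm_sq_pos z
    calc _ = 2 * (1 / √(1 + ‖α / z‖ ^ 2)) := by ring
      _ ≤ 2 * (‖z‖ / (m * √(1 + ‖z‖ ^ 2))) := mul_le_mul_of_nonneg_left (key z hz) (by positivity)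
      _ = 1 / m * (2 * ‖0 - z‖ / (√(1 + ‖(0:ℂ)‖ ^ 2) * √(1 + ‖z‖ ^ 2))) := by
        simp; field_simp
      _ ≤ _ := by gcongr
  refine ⟨‖α‖ / m ^ 2, by positivity, fun z w ↦ ?_⟩
  induction z using OnePoint.rec with
  | infty =>
    induction w using OnePoint.rec with
    | infty => simp
    | coe w =>
      by_cases hw : w = 0
      · subst hw; simp; linarith
      · exact key2 w hw
  | coe z =>
    induction w using OnePoint.rec with
    | infty =>
      rw [chordalDist_comm, chordalDist_comm z]
      by_cases hz : z = 0
      · subst hz; simp; linarith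
      · exact key2 z hz
    | coe w =>
      by_cases hz : z = 0
      · by_cases hw : w = 0
        · simp [hz, hw]
        · rw [hz]; exact key3 w hw
      · by_cases hw : w = 0
        · rw [hw, chordalDist_comm, chordalDist_comm z]; exact key3 z hz
        · have hz' : 0 < ‖z‖ := norm_pos_iff.2 hz
          have hw' : 0 < ‖w‖ := norm_pos_iff.2 hw
          rw [divMap_coe_of_ne α hz, divMap_coe_of_ne α hw, chordalDist_coe_coe,
            chordalDist_coe_coe]
          have h1 : ‖α / z - α / w‖ = ‖α‖ * ‖z - w‖ / (‖z‖ * ‖w‖) := by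
            rw [norm_sub_rev z w, ← norm_mul, ← norm_mul, ← norm_div]
            congr 1; field_simp
          have hc := sqrt_one_add_norm_sq_pos z
          have hc' := sqrt_one_add_norm_sq_pos w
          calc _ = 2 * (‖α‖ * ‖z - w‖ / (‖z‖ * ‖w‖)) *
                ((1 / √(1 + ‖α / z‖ ^ 2)) * (1 / √(1 + ‖α / w‖ ^ 2))) := by
                rw [h1]; field_simp
            _ ≤ 2 * (‖α‖ * ‖z - w‖ / (‖z‖ * ‖w‖)) *
                ((‖z‖ / (m * √(1 + ‖z‖ ^ 2))) * (‖w‖ / (m * √(1 + ‖w‖ ^ 2)))) := 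
                mul_le_mul_of_nonneg_left (mul_le_mul (key z hz) (key w hw) (by positivity)
                  (by positivity)) (by positivity)
            _ = _ := by field_simp

/-! ### Escape to infinity and growth of iterates. -/

lemma iterate_onePointMap (f : ℂ → ℂ) (n : ℕ) (z : ℂ) :
    (OnePoint.map f)^[n] z = ((f^[n] z : ℂ) : OnePoint ℂ) :=
  ((Function.Semiconj.iterate_right (f := ((↑) : ℂ → OnePoint ℂ)) (ga := f)
    (gb := OnePoint.map f) (fun _ ↦ rfl) n).eq z).symm

lemma iterate_onePointMap_infty (f : ℂ → ℂ) (n : ℕ) : (OnePoint.map f)^[n] ∞ = ∞ :=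
  Function.iterate_fixed rfl n

/-- `f` is an entire function with `f z = z ^ d + O(z ^ (d - 2))` for large `z`, with explicit
constant `C`. -/
structure IsCenteredAtInfty (f : ℂ → ℂ) (d : ℕ) (C : ℝ) : Prop where
  two_le : 2 ≤ d
  nonneg : 0 ≤ C
  differentiable : Differentiable ℂ f
  norm_sub_pow_bound : ∀ z, 1 ≤ ‖z‖ → ‖f z - z ^ d‖ ≤ C * ‖z‖ ^ (d - 2)

/-- Centering removes the term of degree `d - 1`, so the relative error is `O(‖z‖⁻²)` and not merely
`O(‖z‖⁻¹)`; the rigidity argument depends on this gain. -/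
lemma IsNormalizedPolynomial.exists_isCenteredAtInfty {p : ℂ[X]} (hp : IsNormalizedPolynomial p) :
    ∃ C, IsCenteredAtInfty (fun z ↦ p.eval z) p.natDegree C := by
  obtain ⟨h2, hm, hc⟩ := hp
  obtain ⟨k, hk⟩ := Nat.exists_eq_add_of_le' h2
  refine ⟨∑ i ∈ Finset.range (k + 1), ‖p.coeff i‖, h2, by positivity, p.differentiable,
    fun z hz ↦ ?_⟩
  have h1 : p.eval z - z ^ p.natDegree = ∑ i ∈ Finset.range (k + 1), p.coeff i * z ^ i := by
    rw [eval_eq_sum_range, Finset.sum_range_succ, hm.coeff_natDegree, hk, Finset.sum_range_succ]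
    rw [hk] at hc
    simp only [Nat.add_succ_sub_one] at hc
    simp [hc]
  rw [h1, hk, Nat.add_sub_cancel, Finset.sum_mul]
  refine norm_sum_le_of_le _ fun i hi ↦ ?_
  rw [norm_mul, norm_pow]
  gcongr
  exact Finset.mem_range_succ_iff.1 hi

/-- The points whose whole forward orbit stays in the closed disc of radius `r`. -/
def boundedOrbitSet (f : ℂ → ℂ) (r : ℝ) : Set ℂ := {z | ∀ n, ‖f^[n] z‖ ≤ r}

namespace IsCenteredAtInfty

variable {f : ℂ → ℂ} {d : ℕ} {C : ℝ}

lemma differentiable_iterate (h : IsCenteredAtInfty f d C) (n : ℕ) : Differentiable ℂ f^[n] :=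
  h.differentiable.iterate n

lemma norm_sub_pow_le (h : IsCenteredAtInfty f d C) {z : ℂ} (hz : C + 3 ≤ ‖z‖) :
    ‖f z - z ^ d‖ ≤ C / ‖z‖ ^ 2 * ‖z‖ ^ d := by
  have hC := h.nonneg
  have hz0 : 0 < ‖z‖ := by linarith
  obtain ⟨k, rfl⟩ := Nat.exists_eq_add_of_le' h.two_le
  refine (h.norm_sub_pow_bound z (by linarith)).trans_eq ?_
  rw [Nat.add_sub_cancel, pow_add]
  field_simp

lemma div_sq_le_half (h : IsCenteredAtInfty f d C) {z : ℂ} (hz : C + 3 ≤ ‖z‖) :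
    C / ‖z‖ ^ 2 ≤ 1 / 2 := by
  have hC := h.nonneg
  rw [div_le_div_iff₀ (by nlinarith) (by norm_num)]
  nlinarith

lemma abs_norm_div_sub_one_le (h : IsCenteredAtInfty f d C) {z : ℂ} (hz : C + 3 ≤ ‖z‖) :
    |‖f z‖ / ‖z‖ ^ d - 1| ≤ C / ‖z‖ ^ 2 := by
  have hC := h.nonneg
  have hz0 : 0 < ‖z‖ := by linarith
  have h1 := (abs_norm_sub_norm_le (f z) (z ^ d)).trans (h.norm_sub_pow_le hz)
  rw [norm_pow] at h1
  rw [div_sub_one (by positivity), abs_div, abs_of_pos (a := ‖z‖ ^ d) (by positivity),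
    div_le_iff₀ (by positivity)]
  exact h1

/-- Makes `C + 3` an escape radius: `‖f z‖ ≥ ‖z‖² - C ≥ 2 ‖z‖` beyond it. -/
lemma two_mul_norm_le (h : IsCenteredAtInfty f d C) {z : ℂ} (hz : C + 3 ≤ ‖z‖) :
    2 * ‖z‖ ≤ ‖f z‖ := by
  have hC := h.nonneg
  have hz0 : 0 < ‖z‖ := by linarith
  have h1 := abs_le.1 (h.abs_norm_div_sub_one_le hz)
  have h2 : 1 - C / ‖z‖ ^ 2 ≤ ‖f z‖ / ‖z‖ ^ d := by linarith
  rw [le_div_iff₀ (by positivity)] at h2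
  have h3 : ‖z‖ ^ 2 ≤ ‖z‖ ^ d := pow_le_pow_right₀ (by linarith) h.two_le
  have h4 : 0 ≤ 1 - C / ‖z‖ ^ 2 := by linarith [h.div_sq_le_half hz]
  have h5 : (1 - C / ‖z‖ ^ 2) * ‖z‖ ^ 2 = ‖z‖ ^ 2 - C := by field_simp
  nlinarith

lemma two_pow_mul_norm_le (h : IsCenteredAtInfty f d C) {z : ℂ} (hz : C + 3 ≤ ‖z‖) (n : ℕ) :
    2 ^ n * ‖z‖ ≤ ‖f^[n] z‖ := by
  induction n with
  | zero => simp
  | succ n ih =>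
    rw [Function.iterate_succ_apply']
    have h1 : 1 * ‖z‖ ≤ 2 ^ n * ‖z‖ := by gcongr; exact one_le_pow₀ one_le_two
    have := h.two_mul_norm_le (z := f^[n] z) (by linarith)
    rw [pow_succ]; linarith

lemma norm_le_norm_iterate (h : IsCenteredAtInfty f d C) {z : ℂ} (hz : C + 3 ≤ ‖z‖) (n : ℕ) :
    ‖z‖ ≤ ‖f^[n] z‖ := by
  refine le_trans ?_ (h.two_pow_mul_norm_le hz n)
  exact le_mul_of_one_le_left (norm_nonneg _) (one_le_pow₀ one_le_two)

lemma abs_log_norm_sub_le (h : IsCenteredAtInfty f d C) {z : ℂ} (hz : C + 3 ≤ ‖z‖) :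
    |Real.log ‖f z‖ - d * Real.log ‖z‖| ≤ 2 * C / ‖z‖ ^ 2 := by
  have hC := h.nonneg
  have hz0 : 0 < ‖z‖ := by linarith
  have hf0 : 0 < ‖f z‖ := by linarith [h.two_mul_norm_le hz]
  have h1 := abs_le.1 (h.abs_norm_div_sub_one_le hz)
  have h2 := h.div_sq_le_half hz
  have hs : 0 ≤ C / ‖z‖ ^ 2 := by positivity
  rw [← Real.log_pow, ← Real.log_div hf0.ne' (by positivity), mul_div_assoc]
  set t := ‖f z‖ / ‖z‖ ^ d
  have ht : 0 < t := by positivity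
  rw [abs_le]
  constructor
  · refine le_trans ?_ (Real.one_sub_inv_le_log_of_pos ht)
    rw [← one_div, one_sub_div ht.ne', le_div_iff₀ ht]
    nlinarith
  · linarith [Real.log_le_sub_one_of_pos ht]

/-- A quantitative form of "Green function = `log ‖z‖ + O(‖z‖⁻²)`" at finite level, with a bound
uniform in `n`. -/
lemma abs_log_norm_iterate_div_sub_le (h : IsCenteredAtInfty f d C) {z : ℂ} (hz : C + 3 ≤ ‖z‖)
    (n : ℕ) : |Real.log ‖f^[n] z‖ / d ^ n - Real.log ‖z‖| ≤ 2 * C / ‖z‖ ^ 2 := by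
  have hC := h.nonneg
  have hz0 : 0 < ‖z‖ := by linarith
  have hd : (2 : ℝ) ≤ d := by exact_mod_cast h.two_le
  -- The factor `1 - (1 / 2) ^ n` is the partial geometric sum of the telescoping errors, step `n`
  -- costing at most `d ^ (-(n + 1)) ≤ 2 ^ (-(n + 1))`.
  suffices hn : |Real.log ‖f^[n] z‖ / d ^ n - Real.log ‖z‖| ≤ 2 * C / ‖z‖ ^ 2 * (1 - (1 / 2) ^ n) by
    refine hn.trans (mul_le_of_le_one_right (by positivity) ?_)
    linarith [show (0 : ℝ) ≤ (1 / 2) ^ n by positivity]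
  induction n with
  | zero => simp
  | succ n ih =>
    have hw := h.norm_le_norm_iterate hz n
    have h1 := h.abs_log_norm_sub_le (z := f^[n] z) (by linarith)
    rw [Function.iterate_succ_apply']
    set w := f^[n] z
    have h2 : |Real.log ‖f w‖ / d ^ (n + 1) - Real.log ‖w‖ / d ^ n|
        ≤ 2 * C / ‖z‖ ^ 2 * (1 / 2) ^ (n + 1) := by
      have : Real.log ‖f w‖ / d ^ (n + 1) - Real.log ‖w‖ / d ^ n =
          (Real.log ‖f w‖ - d * Real.log ‖w‖) * (1 / d) ^ (n + 1) := by
        rw [one_div, inv_pow, pow_succ]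
        field_simp
      rw [this, abs_mul, abs_of_pos (a := (1 / (d : ℝ)) ^ (n + 1)) (by positivity)]
      refine mul_le_mul (h1.trans ?_) ?_ (by positivity) (by positivity)
      · gcongr
      · gcongr
    have h3 := abs_sub_le (Real.log ‖f w‖ / d ^ (n + 1)) (Real.log ‖w‖ / d ^ n) (Real.log ‖z‖)
    refine h3.trans ((add_le_add h2 ih).trans_eq ?_)
    ring

lemma isClosed_boundedOrbitSet (h : IsCenteredAtInfty f d C) (r : ℝ) :
    IsClosed (boundedOrbitSet f r) := by
  rw [boundedOrbitSet, Set.ofPred_forall]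
  exact isClosed_iInter fun n ↦
    isClosed_le (h.differentiable_iterate n).continuous.norm continuous_const

lemma isCompact_boundedOrbitSet (h : IsCenteredAtInfty f d C) (r : ℝ) :
    IsCompact (boundedOrbitSet f r) :=
  (isCompact_closedBall (0 : ℂ) r).of_isClosed_subset (h.isClosed_boundedOrbitSet r)
    fun _ hz ↦ mem_closedBall_zero_iff.2 (hz 0)

lemma exists_forall_lt_norm_iterate (h : IsCenteredAtInfty f d C) {z : ℂ}
    (hz : z ∉ boundedOrbitSet f (C + 3)) (T : ℝ) : ∃ N, ∀ n ≥ N, T < ‖f^[n] z‖ := by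
  have hC := h.nonneg
  simp only [boundedOrbitSet, Set.mem_ofPred_eq, not_forall, not_le] at hz
  obtain ⟨N, hN⟩ := hz
  obtain ⟨m, hm⟩ := pow_unbounded_of_one_lt T one_lt_two
  refine ⟨m + N, fun n hn ↦ ?_⟩
  obtain ⟨j, rfl⟩ := Nat.exists_eq_add_of_le hn
  rw [show m + N + j = (j + m) + N by ring, Function.iterate_add_apply]
  refine hm.trans_le (le_trans ?_ (h.two_pow_mul_norm_le hN.le _))
  calc (2 : ℝ) ^ m ≤ 2 ^ (j + m) := pow_le_pow_right₀ one_le_two (by omega)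
    _ ≤ _ := le_mul_of_one_le_right (by positivity) (by linarith)

lemma chordalDist_lt_of_lt_norm {z w : ℂ} {ε : ℝ} (hε : 0 < ε) (hz : 4 / ε < ‖z‖)
    (hw : 4 / ε < ‖w‖) : chordalDist z w < ε := by
  have hz1 : ‖z‖ ≤ √(1 + ‖z‖ ^ 2) := Real.le_sqrt_of_sq_le (by linarith)
  have hw1 : ‖w‖ ≤ √(1 + ‖w‖ ^ 2) := Real.le_sqrt_of_sq_le (by linarith)
  have h4 : 0 < 4 / ε := by positivity
  have hz0 : 0 < ‖z‖ := h4.trans hz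
  have hw0 : 0 < ‖w‖ := h4.trans hw
  rw [div_lt_iff₀ hε] at hz hw
  rw [chordalDist_coe_coe]
  calc _ ≤ 2 * (‖z‖ + ‖w‖) / (‖z‖ * ‖w‖) := by
        gcongr
        exact norm_sub_le _ _
    _ < ε := by
        rw [div_lt_iff₀ (by positivity)]
        nlinarith

/-! ### The Julia set lies between the filled Julia set and its boundary. -/

lemma juliaSet_subset (h : IsCenteredAtInfty f d C) :
    juliaSet (OnePoint.map f) ⊆ (↑) '' boundedOrbitSet f (C + 3) := by
  have hC := h.nonneg
  rw [juliaSet, Set.compl_subset_comm]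
  refine Set.subset_sUnion_of_mem ⟨?_, ?_⟩
  · rw [OnePoint.isOpen_compl_image_coe]
    exact ⟨h.isClosed_boundedOrbitSet _, h.isCompact_boundedOrbitSet _⟩
  · intro z hz ε hε
    induction z using OnePoint.rec with
    | infty =>
      have hT : 0 < C + 3 + 2 / ε := by positivity
      refine ⟨2 / √(1 + (C + 3 + 2 / ε) ^ 2), by positivity, fun w hw hlt n hn ↦ ?_⟩
      rw [iterate_onePointMap_infty]
      induction w using OnePoint.rec with
      | infty => simpa [iterate_onePointMap_infty] using hε
      | coe w =>
        rw [iterate_onePointMap, chordalDist_infty_coe]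
        rw [chordalDist_infty_coe] at hlt
        have hw' : C + 3 + 2 / ε < ‖w‖ := by
          by_contra! hle
          refine hlt.not_ge ?_
          gcongr
        have h2 := h.norm_le_norm_iterate (z := w) (by linarith [show 0 < 2 / ε by positivity]) n
        rw [div_lt_iff₀ (by positivity)]
        have h3 : ‖f^[n] w‖ ≤ √(1 + ‖f^[n] w‖ ^ 2) := Real.le_sqrt_of_sq_le (by linarith)
        have h4 : 2 / ε < √(1 + ‖f^[n] w‖ ^ 2) := by linarith
        rwa [div_lt_iff₀' hε] at h4
    | coe z =>
      have hzK : z ∉ boundedOrbitSet f (C + 3) := fun hmem ↦ hz ⟨z, hmem, rfl⟩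
      obtain ⟨N, hN⟩ := h.exists_forall_lt_norm_iterate hzK (C + 3 + 4 / ε)
      have hε4 : 0 < 4 / ε := by positivity
      -- On `V` the first `N` iterates stay close to those of `z` by continuity; from time `N` on
      -- both orbits are near `∞`, hence chordally close.
      set V : Set ℂ := {w | C + 3 + 4 / ε < ‖f^[N] w‖} ∩
        ⋂ n ∈ Finset.range N, {w | ‖f^[n] z - f^[n] w‖ < ε / 2}
      have hV : IsOpen V := by
        refine (isOpen_lt continuous_const (h.differentiable_iterate N).continuous.norm).inter
          (isOpen_biInter_finset fun n _ ↦ ?_)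
        exact isOpen_lt (continuous_const.sub (h.differentiable_iterate n).continuous).norm
          continuous_const
      have hzV : z ∈ V := ⟨hN N le_rfl, by simpa using fun _ _ ↦ hε⟩
      obtain ⟨δ, hδ, hsub⟩ := isOpen_iff_chordalDist.1 (OnePoint.isOpen_image_coe.2 hV) z
        ⟨z, hzV, rfl⟩
      refine ⟨δ, hδ, fun w _ hlt n _ ↦ ?_⟩
      obtain ⟨w, ⟨hw1, hw2⟩, rfl⟩ := hsub w hlt
      rw [iterate_onePointMap, iterate_onePointMap]
      rcases lt_or_ge n N with hn | hn
      · have := Set.mem_iInter₂.1 hw2 n (Finset.mem_range.2 hn)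
        simp only [Set.mem_ofPred_eq] at this
        linarith [chordalDist_coe_le (f^[n] z) (f^[n] w)]
      · refine chordalDist_lt_of_lt_norm hε (by linarith [hN n hn]) ?_
        obtain ⟨j, rfl⟩ := Nat.exists_eq_add_of_le' hn
        rw [Function.iterate_add_apply]
        simp only [Set.mem_ofPred_eq] at hw1
        linarith [h.norm_le_norm_iterate (z := f^[N] w) (by linarith) j]

/-- A boundary point has a bounded orbit but escaping neighbours, and the chordal distance between a
bounded and an escaping orbit ends up bounded below. -/
lemma frontier_subset_juliaSet (h : IsCenteredAtInfty f d C) {z : ℂ}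
    (hz : z ∈ frontier (boundedOrbitSet f (C + 3))) :
    (z : OnePoint ℂ) ∈ juliaSet (OnePoint.map f) := by
  have hC := h.nonneg
  rintro ⟨U, ⟨hU, hUf⟩, hzU⟩
  rw [(h.isClosed_boundedOrbitSet _).frontier_eq, Set.mem_sdiff, ← Set.mem_compl_iff,
    ← closure_compl] at hz
  obtain ⟨hzK, hzc⟩ := hz
  obtain ⟨δ, hδ, hδU⟩ := hUf z hzU (1 / (2 * √(1 + (C + 3) ^ 2))) (by positivity)
  have hU' := hU.preimage (OnePoint.continuous_coe (X := ℂ))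
  obtain ⟨w, ⟨hwU, hwball⟩, hwK⟩ := mem_closure_iff.1 hzc _
    (hU'.inter (Metric.isOpen_ball (x := z) (ε := δ / 2))) ⟨hzU, Metric.mem_ball_self (by positivity)⟩
  rw [Metric.mem_ball, dist_comm, dist_eq_norm] at hwball
  obtain ⟨N, hN⟩ := h.exists_forall_lt_norm_iterate hwK (2 * (C + 3))
  have hlt := hδU w hwU (by linarith [chordalDist_coe_le z w]) (N + 1) (by omega)
  have h1 := hN (N + 1) (by omega)
  have h2 := hzK (N + 1)
  rw [iterate_onePointMap, iterate_onePointMap, chordalDist_coe_coe] at hlt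
  set z' := f^[N + 1] z
  set w' := f^[N + 1] w
  refine hlt.not_ge ?_
  have h3 : ‖w'‖ ≤ 2 * ‖z' - w'‖ := by
    have := norm_sub_norm_le w' z'
    rw [norm_sub_rev] at this
    linarith
  have h4 := sqrt_one_add_norm_sq_le w'
  have hw0 : 0 < ‖w'‖ := by linarith
  calc 1 / (2 * √(1 + (C + 3) ^ 2)) = ‖w'‖ / (√(1 + (C + 3) ^ 2) * (2 * ‖w'‖)) := by field_simp
    _ ≤ 2 * ‖z' - w'‖ / (√(1 + ‖z'‖ ^ 2) * √(1 + ‖w'‖ ^ 2)) := by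
      gcongr
      linarith

/-! ### Affine symmetries of a centered map fix the origin. -/

/-- The compact sets `{‖f^[n] z‖ ≤ C + 3}` decrease to the filled Julia set, so an open condition
holding there holds on one of them. -/
lemma exists_forall_norm_le_of_norm_iterate_le (h : IsCenteredAtInfty f d C) {q : ℂ → ℂ}
    (hq : Continuous q) {M : ℝ} (hqK : ∀ z ∈ boundedOrbitSet f (C + 3), ‖q z‖ < M) :
    ∃ N, ∀ n ≥ N, ∀ z, ‖f^[n] z‖ ≤ C + 3 → ‖q z‖ ≤ M := by
  have hstep : ∀ m n z, ‖f^[m + n] z‖ ≤ C + 3 → ‖f^[n] z‖ ≤ C + 3 := by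
    intro m n z hz
    by_contra! hlt
    rw [Function.iterate_add_apply] at hz
    linarith [h.norm_le_norm_iterate hlt.le m]
  set V : ℕ → Set ℂ := fun n ↦ {z | ‖f^[n] z‖ ≤ C + 3}
  have hV : Antitone V := antitone_nat_of_succ_le fun n z hz ↦ hstep 1 n z (by
    rw [add_comm]; exact hz)
  have hcl : ∀ n, IsClosed (V n) := fun n ↦
    isClosed_le (h.differentiable_iterate n).continuous.norm continuous_const
  have hcpt : ∀ n, IsCompact (V n) := fun n ↦
    (isCompact_closedBall (0 : ℂ) (C + 3)).of_isClosed_subset (hcl n) fun z hz ↦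
      mem_closedBall_zero_iff.2 (hstep n 0 z hz)
  obtain ⟨N, hN⟩ := exists_subset_nhds_of_isCompact (V := V) (U := {z | ‖q z‖ < M})
    (directed_of_isDirected_le hV) hcpt fun z hz ↦
      (isOpen_lt hq.norm continuous_const).mem_nhds (hqK z fun n ↦ Set.mem_iInter.1 hz n)
  exact ⟨N, fun n hn z hz ↦ (hN (hV hn hz)).le⟩

/-- A Bernstein–Walsh estimate: `q = f^[k] (a z + b)` is bounded on the filled Julia set by the
maximum principle, so its growth outside is controlled by the Green function. The holomorphic
quotient `q ^ N / f^[n]`, whose two terms both grow like `‖z‖ ^ (d ^ n)`, takes the place of that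
function. -/
lemma log_norm_iterate_affine_div_le (h : IsCenteredAtInfty f d C) {a b : ℂ} (ha : ‖a‖ = 1)
    (hJ : ∀ z ∈ frontier (boundedOrbitSet f (C + 3)), a * z + b ∈ boundedOrbitSet f (C + 3))
    {z : ℂ} (hz : C + 3 < ‖z‖) (hz' : C + 3 ≤ ‖a * z + b‖) (k : ℕ) :
    Real.log ‖f^[k] (a * z + b)‖ / d ^ k ≤
      Real.log (C + 3 + 1) / d ^ k + (Real.log ‖z‖ + 2 * C / ‖z‖ ^ 2) := by
  have hC := h.nonneg
  have hd : (0 : ℝ) < d := by exact_mod_cast (zero_lt_two.trans_le h.two_le)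
  set q : ℂ → ℂ := fun z ↦ f^[k] (a * z + b) with hqdef
  have hq : Differentiable ℂ q :=
    (h.differentiable_iterate k).comp ((differentiable_id.const_mul a).add_const b)
  have hqK : ∀ z ∈ boundedOrbitSet f (C + 3), ‖q z‖ < C + 3 + 1 := fun z hz ↦
    (Complex.norm_le_of_forall_mem_frontier_norm_le (h.isCompact_boundedOrbitSet _).isBounded
      hq.diffContOnCl (fun w hw ↦ hJ w hw k) (subset_closure hz)).trans_lt (by linarith)
  obtain ⟨N₀, hN₀⟩ := h.exists_forall_norm_le_of_norm_iterate_le hq.continuous hqK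
  obtain ⟨n, hnk, hn⟩ : ∃ n, k ≤ n ∧ ∀ z, ‖f^[n] z‖ ≤ C + 3 → ‖q z‖ ≤ C + 3 + 1 :=
    ⟨max k N₀, le_max_left _ _, hN₀ _ (le_max_right _ _)⟩
  set N := d ^ (n - k) with hNdef
  have hN0 : (0 : ℝ) < N := by rw [hNdef]; push_cast; positivity
  have hNd : (N : ℝ) * d ^ k = d ^ n := by
    rw [hNdef]; push_cast; rw [← pow_add, Nat.sub_add_cancel hnk]
  -- Chosen so that on the sphere of radius `T` the accumulated error `(‖b‖ + 4 * C) / S`,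
  -- multiplied by `d ^ k`, is at most `1 ≤ log (C + 4)`.
  set S := C + 3 + d ^ k * (‖b‖ + 4 * C) with hS
  have hS3 : C + 3 ≤ S := by rw [hS]; linarith [show 0 ≤ d ^ k * (‖b‖ + 4 * C) by positivity]
  set T := ‖b‖ + S + ‖z‖ with hT
  have hb := norm_nonneg b
  have hcont := (h.differentiable_iterate n).continuous
  have hsphere : ∀ w, ‖w‖ = T → ‖q w‖ ^ N ≤ (C + 3 + 1) ^ N * ‖f^[n] w‖ := by
    intro w hw
    have hσ1 : ‖a * w + b‖ ≤ T + ‖b‖ := by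
      simpa [ha, hw] using norm_add_le (a * w) b
    have hσ2 : S ≤ ‖a * w + b‖ := by
      have := norm_sub_le_norm_add (a * w) b
      rw [norm_mul, ha, hw] at this
      linarith
    have hw3 : S ≤ ‖w‖ := by linarith
    have hw0 : 0 < ‖w‖ := by linarith
    have hq1 := (abs_le.1 (h.abs_log_norm_iterate_div_sub_le (hS3.trans hσ2) k)).2
    have hf1 := (abs_le.1 (h.abs_log_norm_iterate_div_sub_le (hS3.trans hw3) n)).1
    have hqpos : 0 < ‖q w‖ := by
      linarith [h.norm_le_norm_iterate (hS3.trans hσ2) k]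
    have hfpos : 0 < ‖f^[n] w‖ := by linarith [h.norm_le_norm_iterate (hS3.trans hw3) n]
    have hlog : Real.log ‖a * w + b‖ - Real.log ‖w‖ ≤ ‖b‖ / S := by
      rw [← Real.log_div (by linarith) hw0.ne']
      refine (Real.log_le_sub_one_of_pos (div_pos (by linarith) hw0)).trans ?_
      rw [div_sub_one hw0.ne']
      gcongr
      linarith
    have hsq : ∀ x : ℝ, S ≤ x → 2 * C / x ^ 2 ≤ 2 * C / S := by
      intro x hx
      have : S ≤ x ^ 2 := by nlinarith
      gcongr
    have h1 := hsq _ hσ2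
    have h2 := hsq _ hw3
    have hlog1 : 1 ≤ Real.log (C + 3 + 1) := by
      rw [Real.le_log_iff_exp_le (by linarith)]
      linarith [Real.exp_one_lt_d9]
    have hsmall : (d : ℝ) ^ k * ((‖b‖ + 4 * C) / S) ≤ 1 := by
      rw [← mul_div_assoc, div_le_one (by linarith)]
      linarith
    have hsum : Real.log ‖q w‖ / d ^ k - Real.log ‖f^[n] w‖ / d ^ n ≤ (‖b‖ + 4 * C) / S := by
      have : (‖b‖ + 4 * C) / S = ‖b‖ / S + 2 * C / S + 2 * C / S := by ring
      simp only [hqdef]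
      linarith
    rw [← Real.log_le_log_iff (by positivity) (by positivity),
      Real.log_mul (by positivity) hfpos.ne', Real.log_pow, Real.log_pow]
    have hfin : (d : ℝ) ^ n * (Real.log ‖q w‖ / d ^ k - Real.log ‖f^[n] w‖ / d ^ n) ≤
        N * Real.log (C + 3 + 1) := by
      calc _ ≤ (d : ℝ) ^ n * ((‖b‖ + 4 * C) / S) := by gcongr
        _ = N * (d ^ k * ((‖b‖ + 4 * C) / S)) := by rw [← hNd]; ring
        _ ≤ N * Real.log (C + 3 + 1) := by gcongr; linarith
    have hexp : (d : ℝ) ^ n * (Real.log ‖q w‖ / d ^ k - Real.log ‖f^[n] w‖ / d ^ n) =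
        N * Real.log ‖q w‖ - Real.log ‖f^[n] w‖ := by
      rw [mul_sub, mul_div_cancel₀ _ (by positivity), ← hNd]
      field_simp
    linarith
  -- The boundary of `Ω` consists of points with `‖f^[n] w‖ = C + 3`, where the choice of `n` bounds
  -- `q`, and of points of the outer sphere, handled by `hsphere`.
  set Ω : Set ℂ := {w | C + 3 < ‖f^[n] w‖} ∩ Metric.ball 0 T
  have hΩcl : closure Ω ⊆ {w | C + 3 ≤ ‖f^[n] w‖} :=
    closure_minimal (fun _ hw ↦ (Set.mem_ofPred_eq ▸ hw.1 : _ < _).le) (isClosed_le continuous_const hcont.norm)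
  have hne : ∀ w ∈ closure Ω, f^[n] w ≠ 0 := by
    intro w hw h0
    have := hΩcl hw
    rw [Set.mem_ofPred_eq, h0, norm_zero] at this
    linarith
  have hdiff : DiffContOnCl ℂ (fun w ↦ q w ^ N / f^[n] w) Ω := by
    refine ⟨?_, ?_⟩
    · exact ((hq.pow N).differentiableOn).div (h.differentiable_iterate n).differentiableOn
        fun w hw ↦ hne w (subset_closure hw)
    · exact ((hq.pow N).continuous.continuousOn).div hcont.continuousOn hne
  have hfront : ∀ w ∈ frontier Ω, ‖q w ^ N / f^[n] w‖ ≤ (C + 3 + 1) ^ N := by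
    intro w hw
    have hfpos : 0 < ‖f^[n] w‖ := norm_pos_iff.2 (hne w (frontier_subset_closure hw))
    rw [norm_div, norm_pow, div_le_iff₀ hfpos]
    rcases frontier_inter_subset _ _ hw with ⟨hw1, -⟩ | ⟨-, hw2⟩
    · have heq : C + 3 = ‖f^[n] w‖ := frontier_lt_subset_eq continuous_const hcont.norm hw1
      refine le_trans (pow_le_pow_left₀ (norm_nonneg _) (hn w heq.ge) N) ?_
      exact le_mul_of_one_le_right (by positivity) (by linarith)
    · refine hsphere w ?_
      simpa using Metric.frontier_ball_subset_sphere hw2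
  have hzΩ : z ∈ Ω :=
    ⟨hz.trans_le (h.norm_le_norm_iterate hz.le n), by
      rw [mem_ball_zero_iff]; linarith⟩
  have hmax := Complex.norm_le_of_forall_mem_frontier_norm_le
    (Metric.isBounded_ball.subset Set.inter_subset_right) hdiff hfront (subset_closure hzΩ)
  have hfpos : 0 < ‖f^[n] z‖ := norm_pos_iff.2 (hne z (subset_closure hzΩ))
  have hqpos : 0 < ‖q z‖ := by linarith [h.norm_le_norm_iterate hz' k]
  rw [norm_div, norm_pow, div_le_iff₀ hfpos,
    ← Real.log_le_log_iff (by positivity) (by positivity),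
    Real.log_mul (by positivity) hfpos.ne', Real.log_pow, Real.log_pow] at hmax
  have hf1 := (abs_le.1 (h.abs_log_norm_iterate_div_sub_le hz.le n)).2
  have hdiv : Real.log ‖q z‖ / d ^ k ≤
      Real.log (C + 3 + 1) / d ^ k + Real.log ‖f^[n] z‖ / d ^ n := by
    rw [← hNd, ← sub_nonneg]
    have : Real.log (C + 3 + 1) / d ^ k + Real.log ‖f^[n] z‖ / (N * d ^ k) -
        Real.log ‖q z‖ / d ^ k =
        (N * Real.log (C + 3 + 1) + Real.log ‖f^[n] z‖ - N * Real.log ‖q z‖) / (N * d ^ k) := by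
      field_simp
    rw [this]
    exact div_nonneg (by linarith) (by positivity)
  linarith

/-- Letting `k → ∞` removes the term `log (C + 4) / d ^ k`. -/
lemma log_norm_affine_le (h : IsCenteredAtInfty f d C) {a b : ℂ} (ha : ‖a‖ = 1)
    (hJ : ∀ z ∈ frontier (boundedOrbitSet f (C + 3)), a * z + b ∈ boundedOrbitSet f (C + 3))
    {z : ℂ} (hz : C + 3 < ‖z‖) (hz' : C + 3 ≤ ‖a * z + b‖) :
    Real.log ‖a * z + b‖ ≤ Real.log ‖z‖ + 2 * C / ‖z‖ ^ 2 + 2 * C / ‖a * z + b‖ ^ 2 := by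
  have hd : (1 : ℝ) < d := by exact_mod_cast h.two_le
  have hlim : Filter.Tendsto (fun k : ℕ ↦ Real.log (C + 3 + 1) / (d : ℝ) ^ k +
      (Real.log ‖z‖ + 2 * C / ‖z‖ ^ 2 + 2 * C / ‖a * z + b‖ ^ 2)) Filter.atTop
      (nhds (0 + (Real.log ‖z‖ + 2 * C / ‖z‖ ^ 2 + 2 * C / ‖a * z + b‖ ^ 2))) :=
    (tendsto_const_nhds.div_atTop (tendsto_pow_atTop_atTop_of_one_lt hd)).add_const _
  rw [zero_add] at hlim
  refine ge_of_tendsto' hlim fun k ↦ ?_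
  have h1 := h.log_norm_iterate_affine_div_le ha hJ hz hz' k
  have h2 := (abs_le.1 (h.abs_log_norm_iterate_div_sub_le hz' k)).1
  linarith

lemma translation_eq_zero (h : IsCenteredAtInfty f d C) {a b : ℂ} (ha : ‖a‖ = 1)
    (hJ : ∀ z ∈ frontier (boundedOrbitSet f (C + 3)), a * z + b ∈ boundedOrbitSet f (C + 3)) :
    b = 0 := by
  by_contra hb
  have hC := h.nonneg
  have hb' : 0 < ‖b‖ := norm_pos_iff.2 hb
  have ha0 : a ≠ 0 := by rintro rfl; simp at ha
  -- At `z = t b / a` the image is `(t + 1) b`, so `log` of the norm gains at least `1 / (2 t)`,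
  -- against an allowed error `4 C / (t ‖b‖)²`. The summands of `t` ensure `t ‖b‖² > 8 C`, `t > 1`
  -- and `t ‖b‖ > C + 3`.
  set t : ℝ := 8 * C / ‖b‖ ^ 2 + 1 + (C + 3) / ‖b‖ with ht
  have ht1 : 1 < t := by
    have : 0 < (C + 3) / ‖b‖ := by positivity
    have : 0 ≤ 8 * C / ‖b‖ ^ 2 := by positivity
    linarith
  have htb : C + 3 < t * ‖b‖ := by
    rw [← div_lt_iff₀ hb']
    have : 0 ≤ 8 * C / ‖b‖ ^ 2 := by positivity
    linarith
  have htC : 8 * C < t * ‖b‖ ^ 2 := by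
    rw [← div_lt_iff₀ (by positivity)]
    have : 0 < (C + 3) / ‖b‖ := by positivity
    linarith
  have hz : ‖(t : ℂ) * (b / a)‖ = t * ‖b‖ := by
    rw [norm_mul, norm_div, ha, div_one, Complex.norm_real, Real.norm_of_nonneg (by linarith)]
  have hσz : ‖a * (t * (b / a)) + b‖ = (t + 1) * ‖b‖ := by
    have : a * (t * (b / a)) + b = ((t + 1 : ℝ) : ℂ) * b := by
      push_cast; field_simp
    rw [this, norm_mul, Complex.norm_real, Real.norm_of_nonneg (by linarith)]
  have key := h.log_norm_affine_le ha hJ (z := t * (b / a)) (by rw [hz]; exact htb)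
    (by rw [hσz]; nlinarith)
  rw [hz, hσz] at key
  have h1 : 1 / (2 * t) ≤ Real.log ((t + 1) * ‖b‖) - Real.log (t * ‖b‖) := by
    rw [← Real.log_div (by positivity) (by positivity), mul_div_mul_right _ _ hb'.ne']
    refine le_trans ?_ (Real.one_sub_inv_le_log_of_pos (by positivity))
    rw [inv_div, one_sub_div (by linarith), div_le_div_iff₀ (by linarith) (by linarith)]
    linarith
  have h2 : 2 * C / ((t + 1) * ‖b‖) ^ 2 ≤ 2 * C / (t * ‖b‖) ^ 2 := by
    gcongr
    linarith
  have h3 : 1 / (2 * t) ≤ 4 * C / (t * ‖b‖) ^ 2 := by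
    calc _ ≤ 2 * C / (t * ‖b‖) ^ 2 + 2 * C / (t * ‖b‖) ^ 2 := by linarith
      _ = _ := by ring
  rw [div_le_div_iff₀ (by positivity) (by positivity)] at h3
  nlinarith

end IsCenteredAtInfty

/-! ### The symmetry group of a normalized polynomial. -/

lemma polynomialMap_eq_map {p : ℂ[X]} (hp : 2 ≤ p.natDegree) :
    polynomialMap p = OnePoint.map fun z ↦ p.eval z := by
  funext z
  induction z using OnePoint.rec with
  | infty =>
    have h0 : p.natDegree ≠ 0 := by omega
    simp [polynomialMap, rationalMap, coeff_one, h0]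
  | coe z => simp [polynomialMap, rationalMap]

@[simp] lemma affineMap_coe (a b z : ℂ) : affineMap a b z = ((a * z + b : ℂ) : OnePoint ℂ) := rfl

@[simp] lemma affineMap_infty (a b : ℂ) : affineMap a b ∞ = ∞ := rfl

lemma affineMap_comp (a b a' b' : ℂ) :
    affineMap a b ∘ affineMap a' b' = affineMap (a * a') (a * b' + b) := by
  funext z
  induction z using OnePoint.rec with
  | infty => simp
  | coe z => simp; ring

lemma affineMap_one_zero : affineMap 1 0 = id := by
  funext z
  induction z using OnePoint.rec <;> simp

lemma affineMap_zero_injective : Function.Injective fun a ↦ affineMap a 0 := by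
  intro a a' h
  simpa using congr_fun h ((1 : ℂ) : OnePoint ℂ)

lemma affineMap_divMap {μ : ℂ} (hμ : μ ≠ 0) (α : ℂ) :
    affineMap μ 0 ∘ divMap α = divMap α ∘ affineMap μ⁻¹ 0 := by
  funext z
  induction z using OnePoint.rec with
  | infty => simp
  | coe z =>
    by_cases hz : z = 0
    · simp [hz]
    · have : μ⁻¹ * z ≠ 0 := mul_ne_zero (inv_ne_zero hμ) hz
      simp only [Function.comp_apply, affineMap_coe, divMap_coe_of_ne α hz, add_zero,
        divMap_coe_of_ne α this, OnePoint.coe_eq_coe]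
      field_simp

/-- The symmetries of the Julia set of a normalized polynomial are rotations about the origin. -/
lemma IsNormalizedPolynomial.translation_eq_zero {p : ℂ[X]} (hp : IsNormalizedPolynomial p)
    {a b : ℂ} (h : affineMap a b ∈ symmetryGroup (polynomialMap p)) : ‖a‖ = 1 ∧ b = 0 := by
  obtain ⟨C, hC⟩ := hp.exists_isCenteredAtInfty
  obtain ⟨⟨a', b', ha, hab⟩, hJ⟩ := h
  have hb : b = b' := by simpa using congr_fun hab ((0 : ℂ) : OnePoint ℂ)
  have ha' : a = a' := by simpa [hb] using congr_fun hab ((1 : ℂ) : OnePoint ℂ)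
  rw [← ha'] at ha
  refine ⟨ha, hC.translation_eq_zero ha fun z hz ↦ ?_⟩
  rw [polynomialMap_eq_map hp.1] at hJ
  obtain ⟨w, hw, hwz⟩ := hC.juliaSet_subset
    (hJ ▸ Set.mem_image_of_mem (affineMap a b) (hC.frontier_subset_juliaSet hz))
  rw [affineMap_coe, OnePoint.coe_eq_coe] at hwz
  exact hwz ▸ hw

/-- The multipliers of the rotations about the origin preserving `J`. -/
def rotationSubgroup (J : Set (OnePoint ℂ)) : Subgroup ℂˣ where
  carrier := {u | ‖(u : ℂ)‖ = 1 ∧ affineMap u 0 '' J = J}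
  one_mem' := by simp [affineMap_one_zero]
  mul_mem' := by
    rintro u v ⟨hu, hu'⟩ ⟨hv, hv'⟩
    refine ⟨by simp [hu, hv], ?_⟩
    have h := affineMap_comp u 0 v 0
    rw [mul_zero, add_zero] at h
    rw [Units.val_mul, ← h, Set.image_comp, hv', hu']
  inv_mem' := by
    rintro u ⟨hu, hu'⟩
    refine ⟨by simp [hu], ?_⟩
    have h := affineMap_comp ↑u⁻¹ 0 u 0
    rw [mul_zero, add_zero, Units.inv_mul, affineMap_one_zero] at h
    conv_lhs => rw [← hu']
    rw [← Set.image_comp, h, Set.image_id]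

lemma IsNormalizedPolynomial.rotationSubgroup_eq {p : ℂ[X]} (hp : IsNormalizedPolynomial p) {β : ℕ}
    (hβ0 : β ≠ 0) (hβ : (symmetryGroup (polynomialMap p)).encard = β) :
    rotationSubgroup (juliaSet (polynomialMap p)) = rootsOfUnity β ℂ := by
  set H := rotationSubgroup (juliaSet (polynomialMap p)) with hH
  have hsymm : symmetryGroup (polynomialMap p) = (fun u : ℂˣ ↦ affineMap u 0) '' (H : Set ℂˣ) := by
    ext σ
    constructor
    · intro hσ
      obtain ⟨⟨a, b, ha, rfl⟩, hJ⟩ := id hσ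
      obtain ⟨-, rfl⟩ := hp.translation_eq_zero hσ
      have ha0 : a ≠ 0 := by rintro rfl; simp at ha
      exact ⟨Units.mk0 a ha0, ⟨ha, hJ⟩, rfl⟩
    · rintro ⟨u, ⟨hu, hJ⟩, rfl⟩
      exact ⟨⟨u, 0, hu, rfl⟩, hJ⟩
  have hinj : Function.Injective fun u : ℂˣ ↦ affineMap u 0 :=
    affineMap_zero_injective.comp Units.val_injective
  rw [hsymm, hinj.encard_image] at hβ
  have hcard : Nat.card H = β := by
    have : (H : Set ℂˣ).ncard = β := by rw [Set.ncard, hβ]; rfl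
    rw [← this]; exact Nat.card_coe_set_eq _
  have : NeZero β := ⟨hβ0⟩
  -- By Lagrange a group of order `β` lies in the `β`-th roots of unity, and `ℂ` has exactly `β` of
  -- them.
  refine Subgroup.eq_of_le_of_card_ge (fun u hu ↦ ?_) ?_
  · rw [mem_rootsOfUnity, ← hcard]
    exact congr_arg Subtype.val (pow_card_eq_one' (x := (⟨u, hu⟩ : H)))
  · rw [hcard, Complex.card_rootsOfUnity]

/-! ### The conjugacy from `R` to `p` is `z ↦ α / z`. -/

/-- With `d = p.natDegree`, the coefficients of degree `d - 1` give `d γ α ^ (d - 1) = 0`. -/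
lemma translation_eq_zero_of_comp_eq {p P : ℂ[X]} (hp : IsNormalizedPolynomial p) {α γ : ℂ}
    (hα : α ≠ 0) (hdeg : P.natDegree = p.natDegree) (hP : P.coeff (P.natDegree - 1) = 0)
    (h : p.comp (C α * X + C γ) = C γ + C α * P) : γ = 0 := by
  obtain ⟨h2, hm, hc⟩ := hp
  obtain ⟨k, hk⟩ := Nat.exists_eq_add_of_le' h2
  have hcomp : p.comp (C α * X + C γ) = (taylor γ p).comp (C α * X) := by
    rw [taylor_apply, comp_assoc]; simp
  have h1 := congr_arg (fun q ↦ q.coeff (k + 1)) h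
  have hcoeff : P.coeff (k + 1) = 0 := by rw [← hP, hdeg, hk]; rfl
  have hc' : p.coeff (k + 1) = 0 := by rw [← hc, hk]; rfl
  have hm' : p.coeff (k + 2) = 1 := by rw [← hk]; exact hm
  have hlin : (hasseDeriv (k + 1) p).natDegree ≤ 1 :=
    (natDegree_hasseDeriv_le p (k + 1)).trans (by omega)
  simp only [hcomp, comp_C_mul_X_coeff, coeff_add, coeff_C_succ, coeff_C_mul, hcoeff, taylor_coeff,
    mul_zero, add_zero] at h1
  rw [eq_X_add_C_of_natDegree_le_one hlin] at h1
  simp only [hasseDeriv_coeff, eval_add, eval_mul, eval_C, eval_X, zero_add, hc', mul_zero,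
    add_zero, mul_eq_zero, show 1 + (k + 1) = k + 2 by ring, hm'] at h1
  rcases h1 with (h1 | h1) | h1
  · simp only [one_ne_zero, or_false, Nat.cast_eq_zero, Nat.choose_eq_zero_iff] at h1
    omega
  · exact h1
  · exact absurd (pow_eq_zero_iff (by omega) |>.1 h1) hα

lemma exists_divMap_semiconj (d : ℕ) (hd : 2 ≤ d) (a : ℕ → ℂ) (ha : a d ≠ 0) (ha' : a (d - 1) = 0)
    (R : OnePoint ℂ → OnePoint ℂ)
    (hR : R = rationalMap (X ^ d) (∑ i ∈ Finset.range (d + 1), C (a i) * X ^ (d - i)))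
    (hexc : ∀ w : OnePoint ℂ, IsExceptionalPoint R w → w = ((0 : ℂ) : OnePoint ℂ))
    {p : ℂ[X]} (hp : IsNormalizedPolynomial p) (hconj : IsMobiusConjugate R (polynomialMap p)) :
    ∃ α : ℂ, α ≠ 0 ∧ Function.Semiconj (divMap α) R (polynomialMap p) := by
  obtain ⟨φ, hφ⟩ := hconj
  have hpm := polynomialMap_eq_map hp.1
  have hsemi : Function.Semiconj (φ • ·) R (polynomialMap p) := fun z ↦ by
    simp only [hφ, inv_smul_smul]
  have hφ0 : φ • ((0 : ℂ) : OnePoint ℂ) = ∞ := by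
    rw [← hexc (φ⁻¹ • ∞) ?_, smul_inv_smul]
    refine (Set.finite_singleton (φ⁻¹ • ∞)).subset ?_
    rintro z ⟨n, hn⟩
    have h1 := (hsemi.iterate_right n).eq z
    simp only [hn, smul_inv_smul, hpm] at h1
    rw [Set.mem_singleton_iff, ← inv_smul_smul φ z]
    congr 1
    generalize φ • z = y at h1
    induction y using OnePoint.rec with
    | infty => rfl
    | coe y => rw [iterate_onePointMap] at h1; exact absurd h1.symm (OnePoint.coe_ne_infty _)
  have h11 : φ 1 1 = 0 := by
    rw [OnePoint.smul_some_eq_ite] at hφ0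
    by_contra hne
    simp only [mul_zero, zero_add, hne, if_false] at hφ0
    exact OnePoint.coe_ne_infty _ hφ0
  have hdet := φ.det_ne_zero
  rw [Matrix.det_fin_two, h11, mul_zero, zero_sub, neg_ne_zero] at hdet
  have h01 : φ 0 1 ≠ 0 := left_ne_zero_of_mul hdet
  have h10 : φ 1 0 ≠ 0 := right_ne_zero_of_mul hdet
  set γ := φ 0 0 / φ 1 0 with hγ
  set α := φ 0 1 / φ 1 0 with hα
  have hα0 : α ≠ 0 := div_ne_zero h01 h10
  have hinf : φ • (∞ : OnePoint ℂ) = (γ : OnePoint ℂ) := by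
    rw [OnePoint.smul_infty_eq_ite, if_neg h10]
  have hcoe : ∀ z : ℂ, z ≠ 0 → φ • (z : OnePoint ℂ) = ((γ + α / z : ℂ) : OnePoint ℂ) := by
    intro z hz
    rw [OnePoint.smul_some_eq_ite, h11, add_zero, if_neg (mul_ne_zero h10 hz), OnePoint.coe_eq_coe,
      hγ, hα]
    field_simp
  -- In the coordinate `w = 1 / z` the map `R` becomes the polynomial `P`, whose subleading
  -- coefficient is `a (d - 1) = 0`.
  set P : ℂ[X] := ∑ i ∈ Finset.range (d + 1), C (a i) * X ^ i with hP
  have hPc : ∀ j ≤ d, P.coeff j = a j := by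
    intro j hj
    simp [hP, coeff_X_pow, hj]
  have hPdeg : P.natDegree = d := by
    refine natDegree_eq_of_le_of_coeff_ne_zero (natDegree_sum_le_of_forall_le _ _ fun i hi ↦ ?_)
      (by rwa [hPc d le_rfl])
    exact (natDegree_C_mul_X_pow_le _ _).trans (Finset.mem_range_succ_iff.1 hi)
  have hQ : ∀ w : ℂ, w ≠ 0 →
      (∑ i ∈ Finset.range (d + 1), C (a i) * X ^ (d - i)).eval w⁻¹ = P.eval w / w ^ d := by
    intro w hw
    rw [hP, eval_finsetSum, eval_finsetSum, Finset.sum_div]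
    refine Finset.sum_congr rfl fun i hi ↦ ?_
    simp only [eval_mul, eval_C, eval_pow, eval_X]
    rw [← pow_sub_mul_pow w (Finset.mem_range_succ_iff.1 hi), inv_pow]
    field_simp
  have hcomp : p.comp (C α * X + C γ) = C γ + C α * P := by
    refine eq_of_infinite_eval_eq _ _ ((Set.finite_singleton (0 : ℂ)).infinite_compl.mono ?_)
    intro w hw
    rw [Set.mem_compl_singleton_iff] at hw
    have h1 := hsemi.eq ((w⁻¹ : ℂ) : OnePoint ℂ)
    simp only [hcoe _ (inv_ne_zero hw), hpm, OnePoint.map_some, div_inv_eq_mul] at h1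
    have h2 : R ((w⁻¹ : ℂ) : OnePoint ℂ) =
        if P.eval w = 0 then ∞ else (((P.eval w)⁻¹ : ℂ) : OnePoint ℂ) := by
      rw [hR]
      simp only [rationalMap, hQ w hw, div_eq_zero_iff, pow_eq_zero_iff (show d ≠ 0 by omega), hw,
        or_false, eval_pow, eval_X]
      congr 2
      rw [div_div_eq_mul_div, ← mul_pow, inv_mul_cancel₀ hw, one_pow, one_div]
    rw [h2] at h1
    simp only [Set.mem_ofPred_eq, eval_comp, eval_add, eval_mul, eval_C, eval_X]
    split_ifs at h1 with h0
    · rw [hinf, OnePoint.coe_eq_coe] at h1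
      rw [h0, mul_zero, add_zero, add_comm, ← h1]
    · rw [hcoe _ (inv_ne_zero h0), OnePoint.coe_eq_coe, div_inv_eq_mul] at h1
      rw [h1, add_comm]
  have hdeg : P.natDegree = p.natDegree := by
    have h1 := congr_arg natDegree hcomp
    rw [natDegree_comp, natDegree_linear hα0, mul_one, natDegree_C_add, natDegree_C_mul hα0] at h1
    exact h1.symm
  have hγ0 : γ = 0 := translation_eq_zero_of_comp_eq hp hα0 hdeg
    (by rw [hPdeg, hPc _ (Nat.sub_le _ _), ha']) hcomp
  have hφdiv : (φ • · : OnePoint ℂ → OnePoint ℂ) = divMap α := by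
    funext z
    induction z using OnePoint.rec with
    | infty => rw [hinf, hγ0, divMap_infty]
    | coe z =>
      by_cases hz : z = 0
      · rw [hz, hφ0, divMap_zero]
      · rw [hcoe z hz, hγ0, zero_add, divMap_coe_of_ne α hz]
  exact ⟨α, hα0, hφdiv ▸ hsemi⟩

/-! ### The symmetry group of `R`. -/

lemma image_affineMap_one_eq {J : Set (OnePoint ℂ)} {a b μ : ℂ} (hσ : affineMap a b '' J = J)
    (hρ : affineMap μ 0 '' J = J) : affineMap 1 ((μ - 1) * b) '' J = J := by
  have h : affineMap 1 ((μ - 1) * b) ∘ affineMap a b ∘ affineMap μ 0 =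
      affineMap μ 0 ∘ affineMap a b := by
    simp only [affineMap_comp]
    congr 1 <;> ring
  calc _ = affineMap 1 ((μ - 1) * b) '' (affineMap a b '' (affineMap μ 0 '' J)) := by rw [hρ, hσ]
    _ = affineMap μ 0 '' (affineMap a b '' J) := by
      rw [← Set.image_comp, ← Set.image_comp, ← Set.image_comp, ← h]; rfl
    _ = J := by rw [hσ, hρ]

theorem mainTheorem3 (d : ℕ) (hd : 2 ≤ d) (a : ℕ → ℂ) (ha : a d ≠ 0) (ha' : a (d - 1) = 0)
    (R : OnePoint ℂ → OnePoint ℂ)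
    (hR : R = rationalMap (X ^ d) (∑ i ∈ Finset.range (d + 1), C (a i) * X ^ (d - i)))
    (hexc : ∀ w : OnePoint ℂ, IsExceptionalPoint R w ↔ w = ((0 : ℂ) : OnePoint ℂ))
    (β : ℕ) (hβ : IsOrderOfRotationalSymmetries R β) (hβ2 : 2 ≤ β)
    (htrans : ∀ b : ℂ, b ≠ 0 → affineMap 1 b '' juliaSet R ≠ juliaSet R) :
    symmetryGroup R = {σ | ∃ μ : ℂ, μ ^ β = 1 ∧ σ = affineMap μ 0} := by
  obtain ⟨p, hp, hconj, hcard⟩ := hβ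
  obtain ⟨α, hα, hsemi⟩ :=
    exists_divMap_semiconj d hd a ha ha' R hR (fun w ↦ (hexc w).1) hp hconj
  obtain ⟨L, hL, hLip⟩ := exists_chordalDist_divMap_le hα
  have hinv := divMap_divMap hα
  have hJ := juliaSet_eq_image_of_semiconj hL hLip hLip hinv hinv hsemi
  have hrot : ∀ μ : ℂ, ‖μ‖ = 1 → (affineMap μ 0 '' juliaSet R = juliaSet R ↔ μ ^ β = 1) := by
    intro μ hμ
    have hμ0 : μ ≠ 0 := by rintro rfl; simp at hμ
    -- The inverse appears because `z ↦ α / z` conjugates the rotation by `μ` to the rotation by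
    -- `μ⁻¹`.
    have hmem : (Units.mk0 μ hμ0)⁻¹ ∈ rotationSubgroup (juliaSet (polynomialMap p)) ↔
        affineMap μ 0 '' juliaSet R = juliaSet R := by
      have h1 : affineMap μ⁻¹ 0 '' juliaSet (polynomialMap p) =
          divMap α '' (affineMap μ 0 '' juliaSet R) := by
        rw [hJ, ← Set.image_comp, affineMap_divMap (inv_ne_zero hμ0), inv_inv, Set.image_comp]
      rw [← hinv.injective.image_injective.eq_iff, ← h1, ← hJ]
      exact ⟨fun h ↦ h.2, fun h ↦ ⟨by simp [hμ], h⟩⟩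
    rw [← hmem, inv_mem_iff, hp.rotationSubgroup_eq (by omega) hcard, mem_rootsOfUnity', Units.val_mk0]
  have hnorm : ∀ μ : ℂ, μ ^ β = 1 → ‖μ‖ = 1 := fun μ hμ ↦
    Complex.norm_eq_one_of_pow_eq_one hμ (by omega)
  ext σ
  constructor
  · rintro ⟨⟨a, b, ha, rfl⟩, hσ⟩
    have hprim := Complex.isPrimitiveRoot_exp β (by omega)
    set μ := Complex.exp (2 * Real.pi * Complex.I / β)
    have hμ := (hrot μ (hnorm μ hprim.pow_eq_one)).2 hprim.pow_eq_one
    have hb : b = 0 := by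
      by_contra hb
      exact htrans _ (mul_ne_zero (sub_ne_zero.2 (hprim.ne_one (by omega))) hb)
        (image_affineMap_one_eq hσ hμ)
    subst hb
    exact ⟨a, (hrot a ha).1 hσ, rfl⟩
  · rintro ⟨μ, hμ, rfl⟩
    exact ⟨⟨μ, 0, hnorm μ hμ, rfl⟩, (hrot μ (hnorm μ hμ)).2 hμ⟩
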